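/- For real numbers $\alpha,\beta,\gamma$ with $\gamma\notin\{0,-1,-2,\dots\}$ and $|z|<1$, let $$F(\alpha,\beta;\gamma;z)=\sum_{n=0}^{\infty}\frac{(\alpha,n)(\beta,n)}{(\gamma,n)}\frac{z^n}{n!},\qquad (\alpha,0)=1,\quad (\alpha,n)=\alpha(\alpha+1)\cdots(\alpha+n-1)\ \ (n\ge 1),$$ be the Gaussian hypergeometric function, and let $\Gamma$ be Euler's gamma function. **Theorem (Elliott's identity).** Let $a,b,c\ge 0$ be real numbers and let $0<x<1$. Put \begin{align*} F_1&=F\left(\tfrac12+a,\,-\tfrac12-c;\,1+a+b;\,x\right),\\ F_2&=F\left(\tfrac12-a,\,\tfrac12+c;\,1+b+c;\,1-x\right),\\ F_3&=F\left(\tfrac12+a,\,\tfrac12-c;\,1+a+b;\,x\right),\\ F_4&=F\left(-\tfrac12-a,\,\tfrac12+c;\,1+b+c;\,1-x\right). \end{align*} Then $$F_1F_2+F_3F_4-F_2F_3=\frac{\Gamma(a+b+1)\,\Gamma(b+c+1)}{\Gamma\left(a+b+c+\tfrac32\right)\Gamma\left(b+\tfrac12\right)}.$$ -/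

import Mathlib

/-!
Divide each `₂F₁` by the Gamma value of its lower parameter, and let `E γ` be the left-hand side
so regularized, with `α` and `β` fixed. The contiguous relations give
`E γ = (γ - α) * (γ - β + 1) * E (γ + 1)`. Iterating expresses the original left-hand side as a
quotient of Pochhammer symbols times the left-hand side at `γ + n`. As `n → ∞` the lower parameters
tend to infinity, so every `₂F₁` tends to `1` and the latter factor to `1 * 1 + 1 * 1 - 1 * 1`,
while by Euler's limit formula the Pochhammer quotient tends to the quotient of Gamma values.
-/

open Complex Filter Topology
open scoped Nat

theorem hasSum_regularizedGaussHGFun (a b c : ℂ) {z : ℂ} (hz : ‖z‖ < 1) :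
    HasSum (fun n : ℕ ↦ (ascPochhammer ℂ n).eval a * (ascPochhammer ℂ n).eval b /
      (n ! * Gamma (c + n)) * z ^ n) (regularizedGaussHGFun a b c z) := by
  have h := (regularizedGaussHGFunSeries a b c).hasSum (x := z) <|
    Metric.eball_subset_eball (radius_regularizedGaussHGFunSeries_ge_one a b c) (by
      simpa [Metric.mem_eball, edist_zero_right, ← ofReal_norm] using hz)
  simpa only [regularizedGaussHGFun, FormalMultilinearSeries.apply_eq_pow_smul_coeff,
    coeff_regularizedGaussHGFunSeries, smul_eq_mul, mul_comm (z ^ _)] using h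

theorem ascPochhammer_eval_mul_add_natCast {S : Type*} [CommSemiring S] (b : S) (n : ℕ) :
    (ascPochhammer S n).eval b * (b + n) = b * (ascPochhammer S n).eval (b + 1) := by
  rw [← ascPochhammer_succ_eval, ascPochhammer_succ_left]
  simp

theorem regularizedGaussHGFun_eq_sub_mul_add_mul (a b c : ℂ) {z : ℂ} (hz : ‖z‖ < 1) :
    regularizedGaussHGFun a b c z =
      (c - b) * regularizedGaussHGFun a b (c + 1) z +
        b * regularizedGaussHGFun a (b + 1) (c + 1) z := by
  refine (hasSum_regularizedGaussHGFun a b c hz).unique ?_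
  refine (((hasSum_regularizedGaussHGFun a b (c + 1) hz).mul_left (c - b)).add
    ((hasSum_regularizedGaussHGFun a (b + 1) (c + 1) hz).mul_left b)).congr_fun fun n ↦ ?_
  have hΓ : (Gamma (c + n))⁻¹ = (c + n) * (Gamma (c + 1 + n))⁻¹ := by
    simpa [add_right_comm] using one_div_Gamma_eq_self_mul_one_div_Gamma_add_one (c + n)
  simp only [div_eq_mul_inv, mul_inv, hΓ]
  linear_combination (ascPochhammer ℂ n).eval a * (n ! : ℂ)⁻¹ * (Gamma (c + 1 + n))⁻¹ * z ^ n *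
    ascPochhammer_eval_mul_add_natCast b n

theorem regularizedGaussHGFun_add_one_sub_self (a b c : ℂ) {z : ℂ} (hz : ‖z‖ < 1) :
    regularizedGaussHGFun a (b + 1) c z - regularizedGaussHGFun a b c z =
      a * z * regularizedGaussHGFun (a + 1) (b + 1) (c + 1) z := by
  have h := (hasSum_regularizedGaussHGFun a (b + 1) c hz).sub
    (hasSum_regularizedGaussHGFun a b c hz)
  rw [← hasSum_nat_add_iff' 1] at h
  simp only [Finset.sum_range_one, ascPochhammer_zero, sub_self, sub_zero, Polynomial.eval_one] at h
  refine h.unique (((hasSum_regularizedGaussHGFun (a + 1) (b + 1) (c + 1) hz).mul_left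
    (a * z)).congr_fun fun n ↦ ?_)
  have hb : (ascPochhammer ℂ (n + 1)).eval (b + 1) - (ascPochhammer ℂ (n + 1)).eval b =
      (n + 1) * (ascPochhammer ℂ n).eval (b + 1) := by
    rw [ascPochhammer_succ_eval, ascPochhammer_succ_eval]
    linear_combination -ascPochhammer_eval_mul_add_natCast b n
  rw [← sub_mul, ← sub_div, ← mul_sub, hb, ascPochhammer_succ_eval,
    ascPochhammer_eval_mul_add_natCast, Nat.factorial_succ, pow_succ]
  push_cast
  rw [← add_assoc, add_right_comm c]
  field_simp

theorem one_sub_mul_regularizedGaussHGFun_add_one (a b c : ℂ) {z : ℂ} (hz : ‖z‖ < 1) :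
    (1 - z) * regularizedGaussHGFun a (b + 1) c z =
      (c - b) * regularizedGaussHGFun a b (c + 1) z +
        (b + (a - c) * z) * regularizedGaussHGFun a (b + 1) (c + 1) z := by
  have ha := regularizedGaussHGFun_eq_sub_mul_add_mul (b + 1) a c hz
  simp only [regularizedGaussHGFun_symm (b + 1)] at ha
  linear_combination regularizedGaussHGFun_add_one_sub_self a b c hz +
    regularizedGaussHGFun_eq_sub_mul_add_mul a b c hz - z * ha

theorem factorial_le_norm_ascPochhammer_eval {s : ℂ} (hs : 1 ≤ s.re) (n : ℕ) :
    (n ! : ℝ) ≤ ‖(ascPochhammer ℂ n).eval s‖ := by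
  induction n with
  | zero => simp
  | succ n ih =>
    have hn : (n + 1 : ℝ) ≤ ‖s + n‖ :=
      calc (n + 1 : ℝ) ≤ (s + n).re := by rw [add_re, natCast_re]; linarith
        _ ≤ ‖s + n‖ := re_le_norm _
    rw [ascPochhammer_succ_eval, norm_mul, Nat.factorial_succ, Nat.cast_mul, mul_comm]
    push_cast
    gcongr

theorem tendsto_inv_ascPochhammer_eval_comap_re_atTop {n : ℕ} (hn : n ≠ 0) :
    Tendsto (fun c : ℂ ↦ ((ascPochhammer ℂ n).eval c)⁻¹) (comap re atTop) (𝓝 0) := by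
  have hnorm : Tendsto (fun c : ℂ ↦ ‖c‖) (comap re atTop) atTop :=
    tendsto_atTop_mono re_le_norm tendsto_comap
  have hdeg : 0 < (ascPochhammer ℂ n).degree := Polynomial.natDegree_pos_iff_degree_pos.1 <| by
    rwa [ascPochhammer_natDegree, Nat.pos_iff_ne_zero]
  exact tendsto_zero_iff_norm_tendsto_zero.2 <|
    (Polynomial.tendsto_norm_atTop _ hdeg hnorm).inv_tendsto_atTop.congr fun c ↦ (norm_inv _).symm

theorem tendsto_ordinaryHypergeometric_comap_re_atTop (a b : ℂ) {z : ℂ} (hz : ‖z‖ < 1) :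
    Tendsto (fun c ↦ ₂F₁ a b c z) (comap re atTop) (𝓝 1) := by
  simp only [ordinaryHypergeometric_eq_tsum, smul_eq_mul]
  rw [← tsum_ite_eq (0 : ℕ) (fun _ ↦ (1 : ℂ))]
  refine tendsto_tsum_of_dominated_convergence
    (hasSum_regularizedGaussHGFun a b 1 hz).summable.norm (fun n ↦ ?_) ?_
  · obtain rfl | hn := eq_or_ne n 0
    · simpa using tendsto_const_nhds
    · simpa [hn] using
        ((tendsto_inv_ascPochhammer_eval_comap_re_atTop hn).const_mul _).mul_const (z ^ n)
  · filter_upwards [preimage_mem_comap (eventually_ge_atTop (1 : ℝ))] with c hc n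
    have hΓ : Gamma (1 + n) = n ! := by rw [add_comm, Gamma_nat_eq_factorial]
    have hle : ‖((ascPochhammer ℂ n).eval c)⁻¹‖ ≤ ‖(n ! : ℂ)⁻¹‖ := by
      rw [norm_inv, norm_inv, Complex.norm_natCast]
      gcongr
      exact factorial_le_norm_ascPochhammer_eval hc n
    rw [hΓ, div_eq_mul_inv, mul_inv]
    calc ‖(n ! : ℂ)⁻¹ * (ascPochhammer ℂ n).eval a * (ascPochhammer ℂ n).eval b *
          ((ascPochhammer ℂ n).eval c)⁻¹ * z ^ n‖
        ≤ ‖(n ! : ℂ)⁻¹ * (ascPochhammer ℂ n).eval a * (ascPochhammer ℂ n).eval b *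
          (n ! : ℂ)⁻¹ * z ^ n‖ := by
          simp only [norm_mul _ (z ^ n), norm_mul _ (_⁻¹)]
          gcongr
      _ = _ := by congr 1; ring

theorem ofReal_ordinaryHypergeometric (a b c x : ℝ) :
    ((₂F₁ a b c x : ℝ) : ℂ) = ₂F₁ (a : ℂ) (b : ℂ) (c : ℂ) (x : ℂ) := by
  have hpoch (s : ℝ) (n : ℕ) :
      (((ascPochhammer ℝ n).eval s : ℝ) : ℂ) = (ascPochhammer ℂ n).eval (s : ℂ) := by
    rw [ascPochhammer_eval₂ ofRealHom]
    exact (Polynomial.eval₂_hom ofRealHom s).symm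
  simp [ordinaryHypergeometric_eq_tsum, ofReal_tsum, hpoch]

theorem ofReal_ne_neg_natCast {s : ℝ} (hs : 0 < s) (n : ℕ) : (s : ℂ) ≠ -n := by
  exact_mod_cast ((neg_nonpos.2 n.cast_nonneg).trans_lt hs).ne'

theorem ascPochhammer_eval_eq_prod_range {S : Type*} [CommSemiring S] (s : S) (n : ℕ) :
    (ascPochhammer S n).eval s = ∏ j ∈ Finset.range n, (s + j) := by
  induction n with
  | zero => simp
  | succ n ih => rw [ascPochhammer_succ_eval, ih, Finset.prod_range_succ]

theorem tendsto_GammaSeq_inv (s : ℂ) :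
    Tendsto (fun n ↦ (GammaSeq s n)⁻¹) atTop (𝓝 (Gamma s)⁻¹) := by
  obtain hs | hs := ne_or_eq (Gamma s) 0
  · exact (GammaSeq_tendsto_Gamma s).inv₀ hs
  · obtain ⟨m, rfl⟩ := (Gamma_eq_zero_iff s).1 hs
    refine tendsto_const_nhds.congr' ?_
    filter_upwards [eventually_ge_atTop m] with n hn
    have : ∏ j ∈ Finset.range (n + 1), (-(m : ℂ) + j) = 0 :=
      Finset.prod_eq_zero (Finset.mem_range.2 (Nat.lt_succ_of_le hn)) (by simp)
    simp [GammaSeq, this, hs]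

/-- The left-hand side of the Elliott identity divided by the Gamma values of the two lower
parameters, in the variables `α = 1 / 2 + a`, `β = 1 / 2 - c`, `γ = 1 + a + b`. The other lower
parameter `1 + b + c` is then `γ - α - β + 1`, so a shift of `γ` shifts both of them. -/
noncomputable def elliottForm (α β γ x : ℂ) : ℂ :=
  regularizedGaussHGFun α (β - 1) γ x *
      regularizedGaussHGFun (1 - α) (1 - β) (γ - α - β + 1) (1 - x) +
    regularizedGaussHGFun α β γ x *
      regularizedGaussHGFun (-α) (1 - β) (γ - α - β + 1) (1 - x) -
    regularizedGaussHGFun (1 - α) (1 - β) (γ - α - β + 1) (1 - x) *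
      regularizedGaussHGFun α β γ x

theorem elliottForm_eq_mul_elliottForm_add_one (α β γ : ℂ) {x : ℂ} (hx : ‖x‖ < 1)
    (hx' : ‖1 - x‖ < 1) :
    elliottForm α β γ x = (γ - α) * (γ - β + 1) * elliottForm α β (γ + 1) x := by
  have hx1 : 1 - x ≠ 0 := fun h ↦ by simp [← sub_eq_zero.1 h] at hx
  have h₁ := regularizedGaussHGFun_eq_sub_mul_add_mul α (β - 1) γ hx
  have h₃ := one_sub_mul_regularizedGaussHGFun_add_one α (β - 1) γ hx
  have h₂ := one_sub_mul_regularizedGaussHGFun_add_one (1 - β) (-α) (γ - α - β + 1) hx'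
  have h₄ := regularizedGaussHGFun_eq_sub_mul_add_mul (1 - β) (-α) (γ - α - β + 1) hx'
  rw [sub_add_cancel] at h₁ h₃
  rw [neg_add_eq_sub] at h₂ h₄
  simp only [regularizedGaussHGFun_symm (1 - β)] at h₂ h₄
  rw [sub_sub_cancel] at h₂
  rw [elliottForm, elliottForm, show γ + 1 - α - β + 1 = γ - α - β + 1 + 1 by ring]
  refine mul_left_cancel₀ hx1 ?_
  set F₁ := regularizedGaussHGFun α (β - 1) γ x
  set F₂ := regularizedGaussHGFun (1 - α) (1 - β) (γ - α - β + 1) (1 - x)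
  set F₃ := regularizedGaussHGFun α β γ x
  set F₄ := regularizedGaussHGFun (-α) (1 - β) (γ - α - β + 1) (1 - x)
  set G₁ := regularizedGaussHGFun α (β - 1) (γ + 1) x
  set G₃ := regularizedGaussHGFun α β (γ + 1) x
  have h₁₃ : (1 - x) * (F₁ - F₃) = x * ((γ - α - β + 1) * G₃ - (γ - β + 1) * G₁) := by
    linear_combination (1 - x) * h₁ - h₃
  linear_combination F₂ * h₁₃ + ((γ - α - β + 1) * G₃ - (γ - β + 1) * G₁) * h₂ + F₄ * h₃ +
    ((γ - (β - 1)) * G₁ + (β - 1 + (α - γ) * x) * G₃) * h₄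

theorem elliottForm_eq_ascPochhammer_mul (α β γ : ℂ) {x : ℂ} (hx : ‖x‖ < 1)
    (hx' : ‖1 - x‖ < 1) (n : ℕ) :
    elliottForm α β γ x = (ascPochhammer ℂ n).eval (γ - α) *
      (ascPochhammer ℂ n).eval (γ - β + 1) * elliottForm α β (γ + n) x := by
  induction n with
  | zero => simp
  | succ n ih =>
    rw [ih, elliottForm_eq_mul_elliottForm_add_one α β (γ + n) hx hx', ascPochhammer_succ_eval,
      ascPochhammer_succ_eval, Nat.cast_succ, ← add_assoc γ]
    ring

theorem Gamma_mul_Gamma_mul_elliottForm {α β γ : ℂ} (hγ : ∀ n : ℕ, γ ≠ -n)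
    (hγ' : ∀ n : ℕ, γ - α - β + 1 ≠ -n) (x : ℂ) :
    Gamma γ * Gamma (γ - α - β + 1) * elliottForm α β γ x =
      ₂F₁ α (β - 1) γ x * ₂F₁ (1 - α) (1 - β) (γ - α - β + 1) (1 - x) +
        ₂F₁ α β γ x * ₂F₁ (-α) (1 - β) (γ - α - β + 1) (1 - x) -
        ₂F₁ (1 - α) (1 - β) (γ - α - β + 1) (1 - x) * ₂F₁ α β γ x := by
  have hΓ := Gamma_ne_zero hγ
  have hΓ' := Gamma_ne_zero hγ'
  simp only [elliottForm, ← ordinaryHypergeometric_div_Gamma_eq hγ,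
    ← ordinaryHypergeometric_div_Gamma_eq hγ']
  field_simp

theorem tendsto_add_natCast_comap_re_atTop (s : ℂ) :
    Tendsto (fun n : ℕ ↦ s + n) atTop (comap re atTop) := by
  rw [tendsto_comap_iff]
  simpa [Function.comp_def] using
    tendsto_atTop_add_const_left _ s.re tendsto_natCast_atTop_atTop

theorem add_natCast_ne_neg_natCast {s : ℂ} (hs : ∀ n : ℕ, s ≠ -n) (m n : ℕ) : s + m ≠ -n :=
  fun h ↦ hs (n + m) (by push_cast; linear_combination h)

theorem tendsto_Gamma_mul_Gamma_mul_elliottForm {α β γ : ℂ} (hγ : ∀ n : ℕ, γ ≠ -n)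
    (hγ' : ∀ n : ℕ, γ - α - β + 1 ≠ -n) {x : ℂ} (hx : ‖x‖ < 1) (hx' : ‖1 - x‖ < 1) :
    Tendsto (fun n : ℕ ↦ Gamma (γ + n) * Gamma (γ - α - β + 1 + n) * elliottForm α β (γ + n) x)
      atTop (𝓝 1) := by
  have hF (a b c : ℂ) {z : ℂ} (hz : ‖z‖ < 1) :
      Tendsto (fun n : ℕ ↦ ₂F₁ a b (c + n) z) atTop (𝓝 1) :=
    (tendsto_ordinaryHypergeometric_comap_re_atTop a b hz).comp
      (tendsto_add_natCast_comap_re_atTop c)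
  have hlim := (((hF α (β - 1) γ hx).mul (hF (1 - α) (1 - β) (γ - α - β + 1) hx')).add
    ((hF α β γ hx).mul (hF (-α) (1 - β) (γ - α - β + 1) hx'))).sub
    ((hF (1 - α) (1 - β) (γ - α - β + 1) hx').mul (hF α β γ hx))
  rw [mul_one, add_sub_cancel_right] at hlim
  refine hlim.congr fun n ↦ ?_
  have hn : γ - α - β + 1 + n = γ + n - α - β + 1 := by ring
  rw [hn, Gamma_mul_Gamma_mul_elliottForm (add_natCast_ne_neg_natCast hγ n)
    (hn ▸ add_natCast_ne_neg_natCast hγ' n)]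

theorem tendsto_ascPochhammer_div_ascPochhammer {s t u v : ℂ} (h : s + t = u + v) :
    Tendsto (fun n ↦ (ascPochhammer ℂ n).eval u * (ascPochhammer ℂ n).eval v /
      ((ascPochhammer ℂ n).eval s * (ascPochhammer ℂ n).eval t)) atTop
      (𝓝 (Gamma s * Gamma t / (Gamma u * Gamma v))) := by
  rw [← tendsto_add_atTop_iff_nat 1, div_eq_mul_inv, mul_inv]
  refine (((GammaSeq_tendsto_Gamma s).mul (GammaSeq_tendsto_Gamma t)).mul
    ((tendsto_GammaSeq_inv u).mul (tendsto_GammaSeq_inv v))).congr' ?_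
  filter_upwards [eventually_ne_atTop 0] with n hn
  have hn' : (n : ℂ) ≠ 0 := Nat.cast_ne_zero.2 hn
  have hpow : (n : ℂ) ^ s * n ^ t = n ^ u * n ^ v := by
    rw [← cpow_add _ _ hn', h, cpow_add _ _ hn']
  have hne (w : ℂ) : (n : ℂ) ^ w ≠ 0 := cpow_ne_zero_iff.2 (.inl hn')
  have hfact : (n ! : ℂ) ≠ 0 := Nat.cast_ne_zero.2 n.factorial_ne_zero
  simp only [GammaSeq, ← ascPochhammer_eval_eq_prod_range, inv_div]
  calc _ = (n : ℂ) ^ s * n ^ t / (n ^ u * n ^ v) * ((n ! : ℂ) / n !) ^ 2 *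
        ((ascPochhammer ℂ (n + 1)).eval u * (ascPochhammer ℂ (n + 1)).eval v /
          ((ascPochhammer ℂ (n + 1)).eval s * (ascPochhammer ℂ (n + 1)).eval t)) := by ring
    _ = _ := by rw [hpow, div_self (mul_ne_zero (hne u) (hne v)), div_self hfact, one_pow, one_mul,
          one_mul]

theorem elliottForm_eq {α β γ : ℂ} (hγ : ∀ n : ℕ, γ ≠ -n)
    (hγ' : ∀ n : ℕ, γ - α - β + 1 ≠ -n) {x : ℂ} (hx : ‖x‖ < 1) (hx' : ‖1 - x‖ < 1) :
    elliottForm α β γ x = (Gamma (γ - α) * Gamma (γ - β + 1))⁻¹ := by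
  have hΓ := mul_ne_zero (Gamma_ne_zero hγ) (Gamma_ne_zero hγ')
  refine mul_left_cancel₀ hΓ (tendsto_nhds_unique (tendsto_const_nhds (f := atTop (α := ℕ))) ?_)
  have hlim := (tendsto_ascPochhammer_div_ascPochhammer
    (show γ + (γ - α - β + 1) = (γ - α) + (γ - β + 1) by ring)).mul
    (tendsto_Gamma_mul_Gamma_mul_elliottForm hγ hγ' hx hx')
  rw [mul_one, div_eq_mul_inv] at hlim
  refine hlim.congr fun n ↦ ?_
  rw [elliottForm_eq_ascPochhammer_mul α β γ hx hx' n, ← Gamma_add_nat_div_Gamma_eq γ hγ,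
    ← Gamma_add_nat_div_Gamma_eq _ hγ']
  have hn := Gamma_ne_zero (add_natCast_ne_neg_natCast hγ n)
  have hn' := Gamma_ne_zero (add_natCast_ne_neg_natCast hγ' n)
  field_simp

/- Where a Gamma function in the denominator has a pole, `Gamma` takes the junk value `0`; so does
then the right-hand side, and this is the correct value of the entire function `1 / Γ`. -/
theorem theorem5p2_general {a b c x : ℂ} (hab : ∀ n : ℕ, 1 + a + b ≠ -n)
    (hbc : ∀ n : ℕ, 1 + b + c ≠ -n) (hx : ‖x‖ < 1) (hx' : ‖1 - x‖ < 1) :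
    ₂F₁ (1 / 2 + a) (-1 / 2 - c) (1 + a + b) x * ₂F₁ (1 / 2 - a) (1 / 2 + c) (1 + b + c) (1 - x) +
        ₂F₁ (1 / 2 + a) (1 / 2 - c) (1 + a + b) x *
          ₂F₁ (-1 / 2 - a) (1 / 2 + c) (1 + b + c) (1 - x) -
        ₂F₁ (1 / 2 - a) (1 / 2 + c) (1 + b + c) (1 - x) *
          ₂F₁ (1 / 2 + a) (1 / 2 - c) (1 + a + b) x =
      Gamma (a + b + 1) * Gamma (b + c + 1) /
        (Gamma (a + b + c + 3 / 2) * Gamma (b + 1 / 2)) := by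
  have hγ' : 1 + a + b - (1 / 2 + a) - (1 / 2 - c) + 1 = 1 + b + c := by ring
  have h := Gamma_mul_Gamma_mul_elliottForm hab (hγ' ▸ hbc) x
  rw [elliottForm_eq hab (hγ' ▸ hbc) hx hx', hγ'] at h
  convert h.symm using 1 <;> ring_nf

theorem theorem5p2 (a b c : ℝ) (ha : 0 ≤ a) (hb : 0 ≤ b) (hc : 0 ≤ c)
    (x : ℝ) (hx0 : 0 < x) (hx1 : x < 1)
    (F₁ F₂ F₃ F₄ : ℝ)
    (hF₁ : F₁ = ₂F₁ (1 / 2 + a) (-1 / 2 - c) (1 + a + b) x)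
    (hF₂ : F₂ = ₂F₁ (1 / 2 - a) (1 / 2 + c) (1 + b + c) (1 - x))
    (hF₃ : F₃ = ₂F₁ (1 / 2 + a) (1 / 2 - c) (1 + a + b) x)
    (hF₄ : F₄ = ₂F₁ (-1 / 2 - a) (1 / 2 + c) (1 + b + c) (1 - x)) :
    F₁ * F₂ + F₃ * F₄ - F₂ * F₃ =
      Real.Gamma (a + b + 1) * Real.Gamma (b + c + 1) /
        (Real.Gamma (a + b + c + 3 / 2) * Real.Gamma (b + 1 / 2)) := by
  subst hF₁ hF₂ hF₃ hF₄
  apply ofReal_injective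
  push_cast [ofReal_ordinaryHypergeometric, ← Gamma_ofReal]
  exact theorem5p2_general (mod_cast ofReal_ne_neg_natCast (by positivity : 0 < 1 + a + b))
    (mod_cast ofReal_ne_neg_natCast (by positivity : 0 < 1 + b + c))
    (by simpa [abs_of_pos hx0]) (by norm_cast; simpa [abs_of_pos (sub_pos.2 hx1)])
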